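/- Let $G=(V,E)$ be a finite, connected, simple undirected graph with $n\ge 1$ nodes, adjacency matrix $A$, degree matrix $D$, Laplacian $L=D-A$ with Moore–Penrose pseudo-inverse $L^\dagger$ (that is, $L^\dagger=\sum_{\lambda_i\neq 0}\lambda_i^{-1}u_iu_i^T$ for an orthonormal eigenbasis $(u_i)$ of $L$ with eigenvalues $\lambda_i$), and let $\Delta_G$ be the diameter of $G$. Fix a landmark node $v\in V$ and a BFS tree $B$ of $G$ rooted at $v$, i.e. a spanning tree in which the distance of every node to $v$ equals its distance to $v$ in $G$. For a spanning tree $T$ of $G$ and $u\in V$ let $\mathcal P_T[u]$ be the path from $u$ to $v$ in $T$, regarded as a sequence of edges directed towards $v$, and let $\mathrm{ps}_T[w]=\frac1n\,|\{u\in V:\ \mathcal P_T[u]\text{ contains a directed edge with tail }w\}|$. Put $$X_1(T,u)=\sum_{(e_1,e_2)\in\mathcal P_B[u]}\Big(\mathbf 1[(e_1,e_2)\in\mathcal P_T[u]]-\mathbf 1[(e_2,e_1)\in\mathcal P_T[u]]\Big),$$ $$X_2(T,u)=\sum_{(e_1,e_2)\in\mathcal P_B[u]}\Big(\mathrm{ps}_T[e_1]\,\mathbf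 1[(e_1,e_2)\in\mathcal P_T[u]]-\mathrm{ps}_T[e_2]\,\mathbf 1[(e_2,e_1)\in\mathcal P_T[u]]\Big),$$ and let $X(T,u)=X_1(T,u)-2X_2(T,u)+\frac1n\sum_{w\in V}X_2(T,w)$ be the per-sample value. Let $T_1,\dots,T_\omega$ be independent uniformly random spanning trees of $G$. The SpanTree (ECC) algorithm outputs, for every $u\in V$, $$(\widetilde{L^\dagger})_{uu}=\mathbf x_1(u)-2\mathbf x_2(u)+\frac1n\sum_{w\in V}\mathbf x_2(w),\qquad \mathbf x_j(u)=\frac1\omega\sum_{i=1}^{\omega}X_j(T_i,u)\quad(j=1,2).$$ Theorem. 1. (Bounded samples) $|X(T,u)|\le 4\Delta_G$ for every spanning tree $T$ of $G$ and every $u\in V$. 2. (Unbiasedness) If $\omega\ge 1$, then $\mathbb E\big[(\widetilde{L^\dagger})_{uu}\big]=(L^\dagger)_{uu}$ for every $u\in V$. 3. (Error guarantee) For all real $\epsilon>0$ and $p_f>0$, if $$\omega\ \ge\ \frac{32\,\Delta_G^2\,\log\!\big(\tfrac{2n}{p_f}\big)}{\epsilon^2},$$ then with probability at least $1-p_f$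 we have $\big|(\widetilde{L^\dagger})_{uu}-(L^\dagger)_{uu}\big|\le\epsilon$ simultaneously for all $u\in V$. (For $\omega=0$, which the bound in 3 permits only if $n=1$ or $p_f\ge 2n$, the output is taken to be $0$.) -/

import Mathlib

namespace SpanTreeECC

noncomputable section

variable {V : Type*} {G : SimpleGraph V}

/-- The type of spanning trees of `G`. -/
def SpanningTree (G : SimpleGraph V) : Type _ :=
  {T : SimpleGraph V // T ≤ G ∧ T.IsTree}

/-- Discrete sigma-algebra: on a finite graph there are finitely many spanning trees. -/
instance : MeasurableSpace (SpanningTree G) := ⊤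

/-- The unique path from `u` to `v` in the spanning tree `T`. -/
def SpanningTree.path (T : SpanningTree G) (u v : V) : T.1.Walk u v :=
  (T.2.2.existsUnique_path u v).choose

theorem SpanningTree.path_isPath (T : SpanningTree G) (u v : V) : (T.path u v).IsPath :=
  (T.2.2.existsUnique_path u v).choose_spec.1

/-- `B` is a breadth-first search tree of `G` rooted at `v`: it realises all distances to `v`.
(Every tree produced by a breadth-first search from `v` has this property.) -/
def SpanningTree.IsBFS (B : SpanningTree G) (v : V) : Prop :=
  ∀ u : V, B.1.dist u v = G.dist u v

/-- With `T` rooted at `v`, the endpoint of the edge that leaves `u` towards the root.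
For the root itself, which has no out-edge, this is the root. -/
def SpanningTree.next (T : SpanningTree G) (v u : V) : V :=
  (T.path u v).snd

/-- With `T` rooted at `v`: `w` is an ancestor of `u` (every node is an ancestor of itself). -/
def SpanningTree.IsAncestor (T : SpanningTree G) (v w u : V) : Prop :=
  w ∈ (T.path u v).support

instance [DecidableEq V] (T : SpanningTree G) (v w u : V) : Decidable (T.IsAncestor v w u) :=
  inferInstanceAs (Decidable (w ∈ (T.path u v).support))

/-- The path support of `w`: every node `u` adds `1 / n` to `w` for each edge `(w, _)` on the path
from `u` to the root `v` in `T`. -/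
def SpanningTree.pathSupport [Fintype V] [DecidableEq V] (T : SpanningTree G) (v w : V) : ℝ :=
  ∑ u : V, ((T.path u v).darts.map fun e =>
    if e.fst = w then 1 / (Fintype.card V : ℝ) else 0).sum

/-- The contribution (before division by the sample size) of the sampled tree `T` to the voltage
`x₁(u)`, with root `v` and BFS tree `B`. -/
def volt₁ [DecidableEq V] (B : SpanningTree G) (v : V) (T : SpanningTree G) (u : V) : ℝ :=
  ((B.path u v).darts.map fun e =>
    (if T.next v e.fst = e.snd ∧ T.IsAncestor v e.fst u then (1 : ℝ) else 0) -
    (if T.next v e.snd = e.fst ∧ T.IsAncestor v e.snd u then (1 : ℝ) else 0)).sum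

/-- The contribution (before division by the sample size) of the sampled tree `T` to the voltage
`x₂(u)`, with root `v` and BFS tree `B`. -/
def volt₂ [Fintype V] [DecidableEq V] (B : SpanningTree G) (v : V) (T : SpanningTree G) (u : V) :
    ℝ :=
  ((B.path u v).darts.map fun e =>
    (if T.next v e.fst = e.snd ∧ T.IsAncestor v e.fst u then T.pathSupport v e.fst else 0) -
    (if T.next v e.snd = e.fst ∧ T.IsAncestor v e.snd u then T.pathSupport v e.snd else 0)).sum

/-- The value that a single sampled tree `T` contributes to the estimate at the node `u`. -/
def sampleValue [Fintype V] [DecidableEq V] (B : SpanningTree G) (v : V) (T : SpanningTree G)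
    (u : V) : ℝ :=
  volt₁ B v T u - 2 * volt₂ B v T u + (1 / (Fintype.card V : ℝ)) * ∑ w : V, volt₂ B v T w

/-- The accumulated voltage `x₁(u)` over `ω` sampled trees. -/
def x₁ [DecidableEq V] (B : SpanningTree G) (v : V) {ω : ℕ} (T : Fin ω → SpanningTree G)
    (u : V) : ℝ :=
  ∑ i : Fin ω, volt₁ B v (T i) u / (ω : ℝ)

/-- The accumulated voltage `x₂(u)` over `ω` sampled trees. -/
def x₂ [Fintype V] [DecidableEq V] (B : SpanningTree G) (v : V) {ω : ℕ}
    (T : Fin ω → SpanningTree G) (u : V) : ℝ :=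
  ∑ i : Fin ω, volt₂ B v (T i) u / (ω : ℝ)

/-- The output of the algorithm at the node `u`, for landmark `v`, BFS tree `B` and sampled
trees `T 0, …, T (ω - 1)`. -/
def estimate [Fintype V] [DecidableEq V] (B : SpanningTree G) (v : V) {ω : ℕ}
    (T : Fin ω → SpanningTree G) (u : V) : ℝ :=
  x₁ B v T u - 2 * x₂ B v T u + (1 / (Fintype.card V : ℝ)) * ∑ w : V, x₂ B v T w

/-- The Laplacian pseudo-inverse `∑ (1 / λᵢ) uᵢ uᵢᵀ`, the sum over the nonzero eigenvalues `λᵢ`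
of the Laplacian `L = D - A`, with `(uᵢ)` an orthonormal basis of eigenvectors. -/
def lapPinv [Fintype V] [DecidableEq V] (G : SimpleGraph V) [DecidableRel G.Adj] :
    Matrix V V ℝ :=
  ∑ i : V, if (G.isHermitian_lapMatrix ℝ).eigenvalues i = 0 then 0 else
    (1 / (G.isHermitian_lapMatrix ℝ).eigenvalues i) •
      Matrix.vecMulVec (G.isHermitian_lapMatrix ℝ |>.eigenvectorBasis i : V → ℝ)
        (G.isHermitian_lapMatrix ℝ |>.eigenvectorBasis i : V → ℝ)

end

end SpanTreeECC

namespace SpanTreeECC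

open SimpleGraph

noncomputable section

variable {V : Type*} {G : SimpleGraph V}

/-! Let τ be the number of spanning trees and N(a,b,x) the number of forests, with at most one
component avoiding v, in which none of a, b, x is joined to v. Cutting x → y turns a tree where this
edge lies on the paths of both a and b to v into a forest that separates a, b, x, but not y, from v;
adding the edge back inverts this (`sum_tree_eq_sum_forest`). Subtracting the count for y → x leaves
N(a,b,x) - N(a,b,y) (`sum_tree_sub`), a potential difference, which telescopes along the path of u
in B. Hence X₁(·,u) sums over all trees to N(u,u,u), and X₂(·,u) to the mean over w of N(u,u,w). The
path from w to v in each tree is a unit flow, so g_w = N(w,w,·)/τ satisfies L g_w = e_w - e_v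
(`lapMatrix_mulVec_forestCount`). Centring g in both arguments gives L†, and the diagonal of the
result is exactly the mean of X (`lapPinv_diag_of_green`). Unbiasedness holds for any spanning tree
B. The BFS property only limits its paths to Δ edges, whence |X| ≤ 4Δ; Hoeffding's inequality and a
union bound over the nodes finish the proof. -/

/-! ### Rooted trees and the removal of one edge -/

theorem SpanningTree.path_eq (T : SpanningTree G) {u v : V} {p : T.1.Walk u v} (hp : p.IsPath) :
    T.path u v = p :=
  (T.2.2.existsUnique_path u v).unique (T.path_isPath u v) hp

theorem SpanningTree.path_self (T : SpanningTree G) (v : V) : T.path v v = .nil :=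
  T.path_eq .nil

theorem SpanningTree.next_self (T : SpanningTree G) (v : V) : T.next v v = v := by
  simp [SpanningTree.next, T.path_self]

theorem SpanningTree.exists_path_eq_cons (T : SpanningTree G) {v x : V} (hx : x ≠ v) :
    ∃ (h : T.1.Adj x (T.next v x)), T.path x v = .cons h (T.path (T.next v x) v) ∧
      x ∉ (T.path (T.next v x) v).support := by
  have hp := T.path_isPath x v
  rcases hq : T.path x v with _ | ⟨h, q⟩
  · exact absurd rfl hx
  · rename_i y
    have hn : T.next v x = y := by simp [SpanningTree.next, hq]
    subst hn
    rw [hq, Walk.cons_isPath_iff] at hp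
    rw [T.path_eq hp.1]
    exact ⟨h, rfl, hp.2⟩

/-- Removing the edge `xy` splits the vertices joined to `x` or `y` into at most two classes. -/
theorem reachable_deleteEdges_or {H : SimpleGraph V} {z w : V} (p : H.Walk z w) (x y : V) :
    (H.deleteEdges {s(x, y)}).Reachable z w ∨ (H.deleteEdges {s(x, y)}).Reachable z x ∨
      (H.deleteEdges {s(x, y)}).Reachable z y := by
  induction p with
  | nil => exact .inl (.refl _)
  | @cons a b c h q ih =>
    by_cases he : s(a, b) = s(x, y)
    · rcases Sym2.eq_iff.1 he with ⟨rfl, rfl⟩ | ⟨rfl, rfl⟩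
      · exact .inr (.inl (.refl _))
      · exact .inr (.inr (.refl _))
    · have hab : (H.deleteEdges {s(x, y)}).Reachable a b :=
        Adj.reachable (by simp [deleteEdges_adj, h, he])
      exact ih.imp hab.trans (Or.imp hab.trans hab.trans)

theorem reachable_deleteEdges_of_notMem_support {H : SimpleGraph V} {z w x y : V}
    (p : H.Walk z w) (hx : x ∉ p.support) : (H.deleteEdges {s(x, y)}).Reachable z w :=
  ⟨p.toDeleteEdge s(x, y) fun h => hx (p.fst_mem_support_of_mem_edges h)⟩

namespace SpanningTree

variable (T : SpanningTree G) {v x y : V}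

theorem ne_root_of_next (hxy : x ≠ y) (h : T.next v x = y) : x ≠ v := by
  rintro rfl
  exact hxy ((T.next_self x).symm.trans h)

theorem adj_of_next (hxy : x ≠ y) (h : T.next v x = y) : T.1.Adj x y :=
  h ▸ (T.exists_path_eq_cons (T.ne_root_of_next hxy h)).1

theorem deleteEdges_reachable_next (hxy : x ≠ y) (h : T.next v x = y) :
    (T.1.deleteEdges {s(x, y)}).Reachable y v := by
  obtain ⟨_, -, hx⟩ := T.exists_path_eq_cons (T.ne_root_of_next hxy h)
  rw [h] at hx
  exact reachable_deleteEdges_of_notMem_support _ hx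

/-- Every tree edge is a bridge, and y keeps its connection to v. -/
theorem deleteEdges_not_reachable (hxy : x ≠ y) (h : T.next v x = y) :
    ¬ (T.1.deleteEdges {s(x, y)}).Reachable x v := fun hr =>
  isBridge_iff.1 (isAcyclic_iff_forall_adj_isBridge.1 T.2.2.isAcyclic (T.adj_of_next hxy h))
    (hr.trans (T.deleteEdges_reachable_next hxy h).symm)

/-- A path to v that survives the cut is the tree path; if it met x, its tail would still join x to
v. -/
theorem deleteEdges_reachable_iff (hxy : x ≠ y) (h : T.next v x = y) (z : V) :
    (T.1.deleteEdges {s(x, y)}).Reachable z v ↔ ¬ T.IsAncestor v x z := by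
  classical
  refine ⟨fun hr hx => ?_, fun hx => reachable_deleteEdges_of_notMem_support _ hx⟩
  obtain ⟨p, hp⟩ := hr.exists_isPath
  rw [IsAncestor, T.path_eq (hp.mapLe (deleteEdges_le _)), Walk.support_mapLe_eq_support] at hx
  exact T.deleteEdges_not_reachable hxy h ⟨p.dropUntil x hx⟩

end SpanningTree

/-! ### The bijection between trees and two-component forests -/

/-- The spanning forests of `G` with at most one component that avoids `v`. -/
def TwoForest (G : SimpleGraph V) (v : V) : Type _ :=
  {F : SimpleGraph V // F ≤ G ∧ F.IsAcyclic ∧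
    ∀ z z', ¬ F.Reachable z v → ¬ F.Reachable z' v → F.Reachable z z'}

/-- Cutting the out-edge of `x` in a tree rooted at `v`. -/
def SpanningTree.cut (T : SpanningTree G) {v x y : V} (hxy : x ≠ y) (h : T.next v x = y) :
    TwoForest G v := by
  refine ⟨T.1.deleteEdges {s(x, y)}, (deleteEdges_le _).trans T.2.1,
    T.2.2.isAcyclic.anti (deleteEdges_le _), ?_⟩
  -- Whatever loses its connection to v must hang on x, since y still reaches v.
  have key : ∀ z, ¬ (T.1.deleteEdges {s(x, y)}).Reachable z v →
      (T.1.deleteEdges {s(x, y)}).Reachable z x := fun z hz =>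
    ((reachable_deleteEdges_or (T.path z v) x y).resolve_left hz).resolve_right
      fun hy => hz (hy.trans (T.deleteEdges_reachable_next hxy h))
  exact fun z z' hz hz' => (key z hz).trans (key z' hz').symm

theorem isTree_sup_edge {v : V} (F : TwoForest G v) {x y : V} (hx : ¬ F.1.Reachable x v)
    (hy : F.1.Reachable y v) : (F.1 ⊔ edge x y).IsTree := by
  have hxy : x ≠ y := by rintro rfl; exact hx hy
  refine ⟨?_, F.2.2.1.sup_edge_of_not_reachable fun h => hx (h.trans hy)⟩
  have : Nonempty V := ⟨x⟩
  rw [connected_iff_exists_forall_reachable]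
  have hyv : (F.1 ⊔ edge x y).Reachable y v := hy.mono le_sup_left
  have hxv : (F.1 ⊔ edge x y).Reachable x v :=
    (Adj.reachable (by simp [edge_adj, hxy])).trans hyv
  refine ⟨v, fun z => .symm ?_⟩
  by_cases hz : F.1.Reachable z v
  · exact hz.mono le_sup_left
  · exact ((F.2.2.2 z x hz hx).mono le_sup_left).trans hxv

/-- Joining the two components of a forest by an edge of `G`. -/
def TwoForest.join {v : V} (F : TwoForest G v) {x y : V} (hxy : G.Adj x y)
    (hx : ¬ F.1.Reachable x v) (hy : F.1.Reachable y v) : SpanningTree G :=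
  ⟨F.1 ⊔ edge x y, sup_le F.2.1 ((edge_le_iff ..).2 (.inr hxy)), isTree_sup_edge F hx hy⟩

theorem TwoForest.next_join {v : V} (F : TwoForest G v) {x y : V} (hxy : G.Adj x y)
    (hx : ¬ F.1.Reachable x v) (hy : F.1.Reachable y v) : (F.join hxy hx hy).next v x = y := by
  classical
  obtain ⟨p, hp⟩ := hy.exists_isPath
  have hadj : (F.1 ⊔ edge x y).Adj x y := by simp [edge_adj, hxy.ne]
  have hq : (Walk.cons hadj (p.mapLe le_sup_left)).IsPath := by
    rw [Walk.cons_isPath_iff, Walk.support_mapLe_eq_support]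
    exact ⟨hp.mapLe _, fun h => hx ⟨p.dropUntil x h⟩⟩
  rw [SpanningTree.next, SpanningTree.path_eq _ (p := Walk.cons hadj (p.mapLe le_sup_left)) hq]
  exact Walk.snd_cons ..

theorem TwoForest.deleteEdges_join {v : V} (F : TwoForest G v) {x y : V}
    (hx : ¬ F.1.Reachable x v) (hy : F.1.Reachable y v) :
    (F.1 ⊔ edge x y).deleteEdges {s(x, y)} = F.1 := by
  have : ¬ F.1.Adj x y := fun h => hx (h.reachable.trans hy)
  ext a b
  simp only [deleteEdges_adj, sup_adj, edge_adj, Set.mem_singleton_iff, Sym2.eq_iff]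
  have := F.1.adj_comm x y
  constructor
  · rintro ⟨h | h, h'⟩
    · exact h
    · tauto
  · refine fun h => ⟨.inl h, ?_⟩
    rintro (⟨rfl, rfl⟩ | ⟨rfl, rfl⟩) <;> tauto

instance [Finite V] : Finite (SpanningTree G) := Subtype.finite
instance [Finite V] {v : V} : Finite (TwoForest G v) := Subtype.finite
instance [Finite V] : Fintype (SpanningTree G) := Fintype.ofFinite _
instance [Finite V] {v : V} : Fintype (TwoForest G v) := Fintype.ofFinite _

open Classical in
/-- Trees in which `x → y` lies on the paths of both `a` and `b` to the root correspond to forests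
whose component avoiding `v` contains `a`, `b`, `x` but not `y`. -/
theorem sum_tree_eq_sum_forest [Finite V] {v x y : V} (hxy : G.Adj x y) (a b : V) :
    ∑ T : SpanningTree G,
      (if T.next v x = y ∧ T.IsAncestor v x a ∧ T.IsAncestor v x b then (1 : ℝ) else 0) =
    ∑ F : TwoForest G v, if ¬ F.1.Reachable a v ∧ ¬ F.1.Reachable b v ∧ ¬ F.1.Reachable x v ∧
      F.1.Reachable y v then (1 : ℝ) else 0 := by
  rw [Finset.sum_boole, Finset.sum_boole]
  congr 1
  refine Finset.card_bij' (fun T hT => T.cut hxy.ne (Finset.mem_filter.1 hT).2.1)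
    (fun F hF => F.join hxy (Finset.mem_filter.1 hF).2.2.2.1 (Finset.mem_filter.1 hF).2.2.2.2)
    ?_ ?_ ?_ ?_
  · intro T hT
    obtain ⟨-, h, ha, hb⟩ := Finset.mem_filter.1 hT
    refine Finset.mem_filter.2 ⟨Finset.mem_univ _, ?_, ?_, ?_, ?_⟩
    · exact fun hr => (T.deleteEdges_reachable_iff hxy.ne h a).1 hr ha
    · exact fun hr => (T.deleteEdges_reachable_iff hxy.ne h b).1 hr hb
    · exact T.deleteEdges_not_reachable hxy.ne h
    · exact T.deleteEdges_reachable_next hxy.ne h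
  · intro F hF
    obtain ⟨-, ha, hb, hx, hy⟩ := Finset.mem_filter.1 hF
    have h := F.next_join hxy hx hy
    have key := (F.join hxy hx hy).deleteEdges_reachable_iff hxy.ne h
    have hd : (F.join hxy hx hy).1.deleteEdges {s(x, y)} = F.1 := F.deleteEdges_join hx hy
    rw [hd] at key
    exact Finset.mem_filter.2 ⟨Finset.mem_univ _, h, not_not.1 (mt (key a).2 ha),
      not_not.1 (mt (key b).2 hb)⟩
  · intro T hT
    have hadj := T.adj_of_next hxy.ne (Finset.mem_filter.1 hT).2.1
    refine Subtype.ext ?_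
    change T.1.deleteEdges {s(x, y)} ⊔ edge x y = T.1
    ext c d
    simp only [deleteEdges_adj, sup_adj, edge_adj, Set.mem_singleton_iff, Sym2.eq_iff]
    constructor
    · rintro (h | ⟨⟨rfl, rfl⟩ | ⟨rfl, rfl⟩, -⟩)
      exacts [h.1, hadj, hadj.symm]
    · intro h
      have := h.ne
      tauto
  · intro F hF
    obtain ⟨-, ha, hb, hx, hy⟩ := Finset.mem_filter.1 hF
    exact Subtype.ext (F.deleteEdges_join hx hy)

/-! ### Forest counts as potentials -/

open Classical in
/-- The number of forests in which none of `a`, `b`, `x` is joined to `v`. -/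
def forestCount [Finite V] (G : SimpleGraph V) (v a b x : V) : ℝ :=
  ∑ F : TwoForest G v,
    if ¬ F.1.Reachable a v ∧ ¬ F.1.Reachable b v ∧ ¬ F.1.Reachable x v then (1 : ℝ) else 0

theorem forestCount_root [Finite V] (v a b : V) : forestCount G v a b v = 0 := by
  simp [forestCount]

theorem forestCount_swap_right [Finite V] (v a b x : V) :
    forestCount G v a b x = forestCount G v a x b := by
  classical
  exact Finset.sum_congr rfl fun F _ => if_congr (by tauto) rfl rfl

/-- Reciprocity: this is the symmetry of the Green function. -/
theorem forestCount_symm [Finite V] (v a b : V) :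
    forestCount G v a a b = forestCount G v b b a := by
  classical
  exact Finset.sum_congr rfl fun F _ => if_congr (by tauto) rfl rfl

-- With indicators p, q for x, y being cut off from v, p(1 - q) - q(1 - p) = p - q: a net current is
-- a potential drop.
open Classical in
theorem sum_tree_sub [Finite V] {v x y : V} (hxy : G.Adj x y) (a b : V) :
    ∑ T : SpanningTree G,
      ((if T.next v x = y ∧ T.IsAncestor v x a ∧ T.IsAncestor v x b then (1 : ℝ) else 0) -
       (if T.next v y = x ∧ T.IsAncestor v y a ∧ T.IsAncestor v y b then (1 : ℝ) else 0)) =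
    forestCount G v a b x - forestCount G v a b y := by
  rw [Finset.sum_sub_distrib, sum_tree_eq_sum_forest hxy, sum_tree_eq_sum_forest hxy.symm,
    forestCount, forestCount, ← Finset.sum_sub_distrib, ← Finset.sum_sub_distrib]
  refine Finset.sum_congr rfl fun F _ => ?_
  by_cases ha : F.1.Reachable a v <;> by_cases hb : F.1.Reachable b v <;>
    by_cases hx : F.1.Reachable x v <;> by_cases hy : F.1.Reachable y v <;> simp [ha, hb, hx, hy]

theorem sum_darts_sub {H : SimpleGraph V} (f : V → ℝ) {u v : V} (p : H.Walk u v) :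
    (p.darts.map fun e => f e.fst - f e.snd).sum = f u - f v := by
  induction p with
  | nil => simp
  | cons h q ih => simp [ih]

theorem sum_list_map_comm {ι α : Type*} (s : Finset ι) (l : List α) (f : ι → α → ℝ) :
    ∑ i ∈ s, (l.map (f i)).sum = (l.map fun a => ∑ i ∈ s, f i a).sum := by
  induction l with
  | nil => simp
  | cons a l ih => simp [Finset.sum_add_distrib, ih]

theorem SpanningTree.adj_of_dart (B : SpanningTree G) (e : B.1.Dart) : G.Adj e.fst e.snd :=
  B.2.1 e.adj

theorem sum_volt₁ [Finite V] [DecidableEq V] (B : SpanningTree G) (v u : V) :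
    ∑ T : SpanningTree G, volt₁ B v T u = forestCount G v u u u := by
  classical
  simp only [volt₁]
  have h := sum_darts_sub (forestCount G v u u) (B.path u v)
  rw [forestCount_root, sub_zero] at h
  rw [sum_list_map_comm, ← h]
  congr 1
  refine List.map_congr_left fun e _ => ?_
  rw [← sum_tree_sub (B.adj_of_dart e) u u]
  simp only [and_self]

/-- A path leaves each of its vertices exactly once, except its endpoint, which it never leaves. -/
theorem sum_darts_fst {H : SimpleGraph V} [DecidableEq V] (c : ℝ) (w : V) {u v : V}
    {p : H.Walk u v} (hp : p.IsPath) :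
    (p.darts.map fun e => if e.fst = w then c else 0).sum =
      if w ≠ v ∧ w ∈ p.support then c else 0 := by
  induction p with
  | nil => simp
  | @cons a b d h q ih =>
    rw [Walk.cons_isPath_iff] at hp
    have hd : a ≠ d := fun h => hp.2 (h ▸ q.end_mem_support)
    simp only [Walk.darts_cons, List.map_cons, List.sum_cons, ih hp.1, Walk.support_cons,
      List.mem_cons]
    by_cases hw : a = w
    · subst hw
      simp [hp.2, hd]
    · simp [hw, Ne.symm hw]

theorem SpanningTree.pathSupport_eq [Fintype V] [DecidableEq V] (T : SpanningTree G) (v w : V) :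
    T.pathSupport v w =
      ∑ u : V, if w ≠ v ∧ T.IsAncestor v w u then 1 / (Fintype.card V : ℝ) else 0 :=
  Finset.sum_congr rfl fun u _ => by
    rw [sum_darts_fst _ _ (T.path_isPath u v)]
    rfl

/-- Expanding the path support as a mean over w turns the weighted indicator into joint events for u
and w, the form that the bijection counts. -/
theorem ite_pathSupport [Fintype V] [DecidableEq V] (T : SpanningTree G) {v x y : V}
    (hxy : x ≠ y) (u : V) :
    (if T.next v x = y ∧ T.IsAncestor v x u then T.pathSupport v x else 0) =
      1 / (Fintype.card V : ℝ) * ∑ w : V,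
        if T.next v x = y ∧ T.IsAncestor v x u ∧ T.IsAncestor v x w then 1 else 0 := by
  rw [T.pathSupport_eq, Finset.mul_sum]
  split_ifs with h
  · simp [h, T.ne_root_of_next hxy h.1]
  · rw [eq_comm]
    exact Finset.sum_eq_zero fun w _ => by
      rw [if_neg (fun h' => h ⟨h'.1, h'.2.1⟩), mul_zero]

theorem sum_volt₂ [Fintype V] [DecidableEq V] (B : SpanningTree G) (v u : V) :
    ∑ T : SpanningTree G, volt₂ B v T u =
      1 / (Fintype.card V : ℝ) * ∑ w : V, forestCount G v u u w := by
  classical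
  simp only [volt₂]
  rw [sum_list_map_comm]
  -- The telescoping runs over the third slot with u and w fixed; its value at u is N(u,w,u) =
  -- N(u,u,w).
  have h1 : ∀ w, forestCount G v u u w = ((B.path u v).darts.map fun e =>
      (forestCount G v u w e.fst - forestCount G v u w e.snd)).sum := fun w => by
    rw [sum_darts_sub, forestCount_root, sub_zero, forestCount_swap_right]
  simp only [h1]
  rw [sum_list_map_comm, ← List.sum_map_mul_left]
  congr 1
  refine List.map_congr_left fun e _ => ?_
  have he := B.adj_of_dart e
  simp only [ite_pathSupport _ he.ne, ite_pathSupport _ he.ne', ← mul_sub,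
    ← Finset.sum_sub_distrib, ← Finset.mul_sum]
  rw [Finset.sum_comm]
  congr 1
  refine Finset.sum_congr rfl fun w _ => ?_
  rw [← sum_tree_sub he u w]
  refine Finset.sum_congr rfl fun T _ => ?_
  congr

/-! ### Tree paths as unit flows; the Green function -/

open Classical in
/-- Whether the path from `w` to the root traverses the edge `x → y`. -/
def SpanningTree.traverses (T : SpanningTree G) (v w x y : V) : ℝ :=
  if x ≠ y ∧ T.next v x = y ∧ T.IsAncestor v x w then 1 else 0

theorem SpanningTree.traverses_root (T : SpanningTree G) (v x y : V) :
    T.traverses v v x y = 0 := by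
  refine if_neg fun ⟨hxy, h, ha⟩ => T.ne_root_of_next hxy h ?_
  simpa [IsAncestor, T.path_self] using ha

theorem SpanningTree.traverses_of_not_adj (T : SpanningTree G) {v x y : V} (w : V)
    (h : ¬ G.Adj x y) : T.traverses v w x y = 0 :=
  if_neg fun h' => h (T.2.1 (T.adj_of_next h'.1 h'.2.1))

theorem SpanningTree.traverses_eq [DecidableEq V] (T : SpanningTree G) {v w : V} (hw : w ≠ v)
    (x y : V) : T.traverses v w x y =
      (if x = w ∧ y = T.next v w then 1 else 0) + T.traverses v (T.next v w) x y := by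
  obtain ⟨h, hp, hn⟩ := T.exists_path_eq_cons hw
  have h' := h.ne
  simp only [traverses, IsAncestor, hp, Walk.support_cons, List.mem_cons]
  by_cases hx : x = w
  · subst hx
    by_cases hy : y = T.next v x
    · simp [hn, hy, h']
    · simp [hn, hy, Ne.symm hy]
  · simp only [hx, false_or, false_and, if_false, zero_add]
    congr

/-- A path to the root is a unit flow. -/
theorem SpanningTree.sum_traverses_sub [Fintype V] [DecidableEq V] (T : SpanningTree G)
    (v w u : V) : ∑ x : V, (T.traverses v w u x - T.traverses v w x u) =
      (if u = w then 1 else 0) - (if u = v then 1 else 0) := by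
  induction hk : (T.path w v).length generalizing w with
  | zero =>
    obtain rfl := Walk.eq_of_length_eq_zero hk
    simp [traverses_root]
  | succ k ih =>
    have hw : w ≠ v := by
      rintro rfl
      simp [T.path_self] at hk
    obtain ⟨hadj, hp, -⟩ := T.exists_path_eq_cons hw
    have hlen : (T.path (T.next v w) v).length = k := by
      rw [hp, Walk.length_cons] at hk
      omega
    simp only [T.traverses_eq hw, add_sub_add_comm, Finset.sum_add_distrib, ih _ hlen]
    simp [ite_and, Finset.sum_sub_distrib]

theorem sum_traverses_sub_eq [Finite V] {v x y : V} (hxy : G.Adj x y) (w : V) :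
    ∑ T : SpanningTree G, (T.traverses v w x y - T.traverses v w y x) =
      forestCount G v w w x - forestCount G v w w y := by
  classical
  rw [← sum_tree_sub hxy]
  refine Finset.sum_congr rfl fun T _ => ?_
  simp [SpanningTree.traverses, hxy.ne, hxy.ne']

/-- The forest counts are, up to scaling, the Green function of the graph grounded at `v`. -/
theorem lapMatrix_mulVec_forestCount [Fintype V] [DecidableEq V] [DecidableRel G.Adj]
    (v w u : V) :
    (G.lapMatrix ℝ).mulVec (forestCount G v w w) u =
      Fintype.card (SpanningTree G) * ((if u = w then 1 else 0) - (if u = v then 1 else 0)) := by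
  rw [lapMatrix_mulVec_apply, ← card_neighborFinset_eq_degree, ← nsmul_eq_mul,
    ← Finset.sum_const, ← Finset.sum_sub_distrib]
  -- The potential drop along an edge is the net flow through it, summed over trees. Non-neighbours
  -- carry no flow, so the sum can run over all x.
  have h1 : ∀ x ∈ G.neighborFinset u, forestCount G v w w u - forestCount G v w w x =
      ∑ T : SpanningTree G, (T.traverses v w u x - T.traverses v w x u) := fun x hx =>
    (sum_traverses_sub_eq ((mem_neighborFinset ..).1 hx) w).symm
  rw [Finset.sum_congr rfl h1, Finset.sum_subset (Finset.subset_univ _), Finset.sum_comm,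
    Finset.sum_congr rfl fun T _ => T.sum_traverses_sub v w u]
  · simp [mul_sub]
  · intro x _ hx
    rw [mem_neighborFinset] at hx
    simp [SpanningTree.traverses_of_not_adj _ _ hx,
      SpanningTree.traverses_of_not_adj _ _ (fun h => hx h.symm)]

/-! ### The Laplacian pseudo-inverse -/

section Pinv

variable [Fintype V] [DecidableEq V] [DecidableRel G.Adj]

open Matrix

theorem lapPinv_apply (x y : V) : lapPinv G x y = ∑ i : V,
    (if (G.isHermitian_lapMatrix ℝ).eigenvalues i = 0 then 0 else
      1 / (G.isHermitian_lapMatrix ℝ).eigenvalues i) *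
      ((G.isHermitian_lapMatrix ℝ).eigenvectorBasis i x *
        (G.isHermitian_lapMatrix ℝ).eigenvectorBasis i y) := by
  rw [lapPinv, Matrix.sum_apply]
  refine Finset.sum_congr rfl fun i _ => ?_
  split_ifs <;> simp [vecMulVec_apply]

theorem lapPinv_symm (x y : V) : lapPinv G x y = lapPinv G y x := by
  simp only [lapPinv_apply, mul_comm]

theorem lapPinv_mulVec_eigenvector (j : V) :
    lapPinv G *ᵥ (G.isHermitian_lapMatrix ℝ).eigenvectorBasis j =
      (if (G.isHermitian_lapMatrix ℝ).eigenvalues j = 0 then 0 else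
        1 / (G.isHermitian_lapMatrix ℝ).eigenvalues j) •
        ((G.isHermitian_lapMatrix ℝ).eigenvectorBasis j : V → ℝ) := by
  set b := (G.isHermitian_lapMatrix ℝ).eigenvectorBasis
  have horth : ∀ i, ∑ y, b i y * b j y = if i = j then 1 else 0 := fun i => by
    have := orthonormal_iff_ite.1 b.orthonormal i j
    rw [← this, PiLp.inner_apply]
    simp [mul_comm]
  ext x
  simp only [mulVec, dotProduct, lapPinv_apply, Finset.sum_mul]
  rw [Finset.sum_comm]
  simp only [mul_assoc, ← Finset.mul_sum, Pi.smul_apply, smul_eq_mul]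
  change ∑ i, _ * (b i x * ∑ y, b i y * b j y) = _
  simp [horth]

/-- On an eigenvector this reads λ · λ⁻¹ · λ = λ, both sides being 0 when λ = 0. -/
theorem lapMatrix_mul_lapPinv_mul_lapMatrix :
    G.lapMatrix ℝ * lapPinv G * G.lapMatrix ℝ = G.lapMatrix ℝ := by
  set hL := G.isHermitian_lapMatrix ℝ
  refine Matrix.toEuclideanLin.injective (hL.eigenvectorBasis.toBasis.ext fun j => ?_)
  simp only [OrthonormalBasis.coe_toBasis, toLpLin_apply, ← mulVec_mulVec,
    hL.mulVec_eigenvectorBasis, mulVec_smul, lapPinv_mulVec_eigenvector]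
  congr 1
  by_cases h : hL.eigenvalues j = 0
  · simp [h]
  · rw [if_neg h, smul_smul, smul_smul]
    congr 1
    field_simp

/-- Constants lie in the kernel of L, hence are orthogonal to every eigenvector with nonzero
eigenvalue. -/
theorem sum_lapPinv (x : V) : ∑ y, lapPinv G x y = 0 := by
  simp only [lapPinv_apply]
  rw [Finset.sum_comm]
  refine Finset.sum_eq_zero fun i _ => ?_
  set hL := G.isHermitian_lapMatrix ℝ
  rw [← Finset.mul_sum, ← Finset.mul_sum]
  split_ifs with h
  · simp
  · have h1 : ∑ y, (G.lapMatrix ℝ *ᵥ hL.eigenvectorBasis i) y = 0 := by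
      have : (fun _ : V => (1 : ℝ)) ⬝ᵥ (G.lapMatrix ℝ *ᵥ hL.eigenvectorBasis i) = 0 := by
        rw [dotProduct_mulVec, ← mulVec_transpose, (G.isSymm_lapMatrix (R := ℝ)).eq,
          lapMatrix_mulVec_const_eq_zero, zero_dotProduct]
      simpa [dotProduct] using this
    rw [hL.mulVec_eigenvectorBasis] at h1
    simp only [Pi.smul_apply, smul_eq_mul, ← Finset.mul_sum, mul_eq_zero, h, false_or] at h1
    rw [h1]
    simp

/-- L annihilates L†Lf - f, which is therefore constant on a connected graph; L†Lf has sum zero,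
which fixes the constant. -/
theorem lapPinv_mulVec_lapMatrix_mulVec (hG : G.Connected) (f : V → ℝ) (x : V) :
    (lapPinv G *ᵥ (G.lapMatrix ℝ *ᵥ f)) x = f x - (1 / (Fintype.card V : ℝ)) * ∑ y, f y := by
  have : Nonempty V := hG.nonempty
  have hn : (Fintype.card V : ℝ) ≠ 0 := by positivity
  set h := lapPinv G *ᵥ (G.lapMatrix ℝ *ᵥ f)
  have hker : G.lapMatrix ℝ *ᵥ (h - f) = 0 := by
    rw [mulVec_sub, mulVec_mulVec, mulVec_mulVec,
      lapMatrix_mul_lapPinv_mul_lapMatrix, sub_self]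
  have hconst := fun y => (lapMatrix_mulVec_eq_zero_iff_forall_reachable G).1 hker x y (hG x y)
  have hsum : ∑ y, h y = 0 := by
    simp only [h, mulVec, dotProduct]
    rw [Finset.sum_comm]
    refine Finset.sum_eq_zero fun z _ => ?_
    rw [← Finset.sum_mul]
    simp only [lapPinv_symm (G := G) _ z, sum_lapPinv, zero_mul]
  have h2 : (Fintype.card V : ℝ) * (h x - f x) = - ∑ y, f y := by
    have : ∑ _y : V, (h x - f x) = ∑ y, (h y - f y) := Finset.sum_congr rfl fun y _ => hconst y
    rw [Finset.sum_sub_distrib (fun y => h y), hsum] at this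
    simpa [mul_sub] using this
  field_simp
  linarith

/-- The pseudo-inverse is the doubly centred Green function of the graph grounded at `v`. -/
theorem lapPinv_diag_of_green (hG : G.Connected) (v : V) (g : V → V → ℝ)
    (hg : ∀ w u, (G.lapMatrix ℝ *ᵥ g w) u =
      (if u = w then 1 else 0) - (if u = v then 1 else 0)) (hsymm : ∀ w u, g w u = g u w) (u : V) :
    lapPinv G u u = g u u - 2 * (1 / (Fintype.card V : ℝ) * ∑ w, g u w) +
      1 / (Fintype.card V : ℝ) * ∑ x, 1 / (Fintype.card V : ℝ) * ∑ w, g x w := by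
  have : Nonempty V := hG.nonempty
  have hn : (Fintype.card V : ℝ) ≠ 0 := by positivity
  -- This is L† applied to L g_w = e_w - e_v.
  have key : ∀ w, lapPinv G u w - lapPinv G u v =
      g w u - 1 / (Fintype.card V : ℝ) * ∑ y, g w y := fun w => by
    rw [← lapPinv_mulVec_lapMatrix_mulVec hG, funext (hg w)]
    simp [mulVec, dotProduct, mul_sub]
  -- Summing over w removes the terms L†(u,w), because rows of L† sum to zero, and isolates L†(u,v).
  have hv : -((Fintype.card V : ℝ) * lapPinv G u v) =
      ∑ w, g w u - ∑ w, 1 / (Fintype.card V : ℝ) * ∑ y, g w y := by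
    rw [← Finset.sum_sub_distrib, ← Finset.sum_congr rfl fun w _ => key w,
      Finset.sum_sub_distrib, sum_lapPinv]
    simp
  have hs : ∑ w, g w u = ∑ w, g u w := Finset.sum_congr rfl fun w _ => hsymm w u
  rw [hs] at hv
  have h3 := key u
  have h4 : lapPinv G u v = -(1 / (Fintype.card V : ℝ) * (∑ w, g u w -
      ∑ w, 1 / (Fintype.card V : ℝ) * ∑ y, g w y)) := by
    rw [← hv]
    field_simp
  rw [h4] at h3
  linear_combination h3

end Pinv

/-! ### Boundedness of the samples -/

/-- The number of edges of a path in a breadth-first search tree is at most the diameter. -/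
theorem SpanningTree.IsBFS.length_le [Finite V] (hG : G.Connected) {B : SpanningTree G} {v : V}
    (hB : B.IsBFS v) (u : V) : (B.path u v).length ≤ G.diam := by
  have : Nonempty V := hG.nonempty
  obtain ⟨p, hp, hl⟩ := B.2.2.connected.exists_path_of_dist u v
  rw [(B.2.2.existsUnique_path u v).unique (B.path_isPath u v) hp, hl, hB u]
  exact dist_le_diam (connected_iff_ediam_ne_top.1 hG)

theorem abs_sum_map_le_length {α : Type*} (l : List α) (f : α → ℝ) (h : ∀ a ∈ l, |f a| ≤ 1) :
    |(l.map f).sum| ≤ l.length := by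
  induction l with
  | nil => simp
  | cons a l ih =>
    simp only [List.mem_cons, forall_eq_or_imp] at h
    simp only [List.map_cons, List.sum_cons, List.length_cons, Nat.cast_add, Nat.cast_one]
    linarith [abs_add_le (f a) (l.map f).sum, ih h.2, h.1]

open MeasureTheory ProbabilityTheory

section Bounds

variable [Fintype V] [DecidableEq V]

theorem SpanningTree.pathSupport_nonneg (T : SpanningTree G) (v w : V) :
    0 ≤ T.pathSupport v w := by
  rw [T.pathSupport_eq]
  exact Finset.sum_nonneg fun u _ => by positivity

theorem SpanningTree.pathSupport_le_one (T : SpanningTree G) (v w : V) :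
    T.pathSupport v w ≤ 1 := by
  have : Nonempty V := ⟨v⟩
  rw [T.pathSupport_eq]
  calc _ ≤ ∑ _u : V, 1 / (Fintype.card V : ℝ) := Finset.sum_le_sum fun u _ => by
        split_ifs
        · rfl
        · positivity
    _ = 1 := by simp

theorem abs_volt₁_le (hG : G.Connected) {v : V} {B : SpanningTree G} (hB : B.IsBFS v)
    (T : SpanningTree G) (u : V) : |volt₁ B v T u| ≤ G.diam := by
  refine (abs_sum_map_le_length _ _ fun e _ => ?_).trans ?_
  · split_ifs <;> norm_num
  · rw [Walk.length_darts]
    exact_mod_cast hB.length_le hG u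

theorem abs_volt₂_le (hG : G.Connected) {v : V} {B : SpanningTree G} (hB : B.IsBFS v)
    (T : SpanningTree G) (u : V) : |volt₂ B v T u| ≤ G.diam := by
  refine (abs_sum_map_le_length _ _ fun e _ => ?_).trans ?_
  · have h1 := T.pathSupport_nonneg v
    have h2 := T.pathSupport_le_one v
    rw [abs_le]
    split_ifs <;> constructor <;> linarith [h1 e.fst, h1 e.snd, h2 e.fst, h2 e.snd]
  · rw [Walk.length_darts]
    exact_mod_cast hB.length_le hG u

/-- The three terms contribute Δ, 2Δ and Δ. -/
theorem abs_sampleValue_le (hG : G.Connected) {v : V} {B : SpanningTree G} (hB : B.IsBFS v)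
    (T : SpanningTree G) (u : V) : |sampleValue B v T u| ≤ 4 * (G.diam : ℝ) := by
  have : Nonempty V := ⟨v⟩
  have hn : (0 : ℝ) < Fintype.card V := by positivity
  have h3 : |(1 / (Fintype.card V : ℝ)) * ∑ w : V, volt₂ B v T w| ≤ G.diam := by
    rw [abs_mul, abs_of_pos (by positivity), one_div, inv_mul_le_iff₀ hn]
    calc _ ≤ ∑ w : V, |volt₂ B v T w| := Finset.abs_sum_le_sum_abs ..
      _ ≤ ∑ _w : V, (G.diam : ℝ) := Finset.sum_le_sum fun w _ => abs_volt₂_le hG hB T w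
      _ = _ := by simp
  have h1 := abs_le.1 (abs_volt₁_le hG hB T u)
  have h2 := abs_le.1 (abs_volt₂_le hG hB T u)
  rw [abs_le] at h3 ⊢
  unfold sampleValue
  constructor <;> linarith

end Bounds

/-! ### Expectation of a sample -/

section Expectation

variable [Fintype V]

theorem card_spanningTree_ne_zero (B : SpanningTree G) :
    (Fintype.card (SpanningTree G) : ℝ) ≠ 0 := by
  have : Nonempty (SpanningTree G) := ⟨B⟩
  positivity

theorem sum_sampleValue [DecidableEq V] [DecidableRel G.Adj] (hG : G.Connected) (B : SpanningTree G) (v u : V) :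
    ∑ T : SpanningTree G, sampleValue B v T u =
      Fintype.card (SpanningTree G) * lapPinv G u u := by
  have hτ := card_spanningTree_ne_zero B
  rw [lapPinv_diag_of_green hG v
    (fun w u => (Fintype.card (SpanningTree G) : ℝ)⁻¹ * forestCount G v w w u) ?_
    (fun w u => by rw [forestCount_symm])]
  · simp only [sampleValue, Finset.sum_add_distrib, Finset.sum_sub_distrib, ← Finset.mul_sum]
    rw [Finset.sum_comm (f := fun T w => volt₂ B v T w)]
    simp only [sum_volt₁, sum_volt₂, ← Finset.mul_sum]
    field_simp
  · intro w u
    have := lapMatrix_mulVec_forestCount (G := G) v w u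
    have hs : (fun u => (Fintype.card (SpanningTree G) : ℝ)⁻¹ * forestCount G v w w u) =
      (Fintype.card (SpanningTree G) : ℝ)⁻¹ • forestCount G v w w := rfl
    rw [hs, Matrix.mulVec_smul, Pi.smul_apply, this, smul_eq_mul, inv_mul_cancel_left₀ hτ]

/-- Linearity in the sampled trees. For ω = 0 both sides are 0. -/
theorem estimate_eq [DecidableEq V] (B : SpanningTree G) (v : V) {ω : ℕ} (T : Fin ω → SpanningTree G) (u : V) :
    estimate B v T u = (∑ i, sampleValue B v (T i) u) / ω := by
  simp only [estimate, x₁, x₂, sampleValue, ← Finset.sum_div, Finset.sum_add_distrib,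
    Finset.sum_sub_distrib, ← Finset.mul_sum]
  rw [Finset.sum_comm (f := fun w i => volt₂ B v (T i) w)]
  ring

variable {Ω : Type*} [MeasurableSpace Ω] {P : Measure Ω} [IsProbabilityMeasure P]

instance : DiscreteMeasurableSpace (SpanningTree G) := ⟨fun _ => trivial⟩

theorem integrable_comp_tree {T : Ω → SpanningTree G} (hT : Measurable T)
    (f : SpanningTree G → ℝ) : Integrable (fun x => f (T x)) P := by
  have : IsProbabilityMeasure (P.map T) := Measure.isProbabilityMeasure_map hT.aemeasurable
  exact (Integrable.of_finite (μ := P.map T) (f := f)).comp_measurable hT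

theorem integral_comp_tree {T : Ω → SpanningTree G} (hT : Measurable T)
    (hunif : ∀ t, P.real {x | T x = t} = 1 / (Nat.card (SpanningTree G) : ℝ))
    (f : SpanningTree G → ℝ) :
    ∫ x, f (T x) ∂P = (∑ t, f t) / Fintype.card (SpanningTree G) := by
  have : IsProbabilityMeasure (P.map T) := Measure.isProbabilityMeasure_map hT.aemeasurable
  rw [← integral_map hT.aemeasurable (f := f) (measurable_from_top.aestronglyMeasurable),
    integral_fintype Integrable.of_finite, Finset.sum_div]
  refine Finset.sum_congr rfl fun t _ => ?_
  rw [map_measureReal_apply hT (measurableSet_singleton t)]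
  have := hunif t
  rw [Nat.card_eq_fintype_card] at this
  rw [show T ⁻¹' {t} = {x | T x = t} from rfl, this, smul_eq_mul]
  ring

theorem integral_sampleValue [DecidableEq V] [DecidableRel G.Adj] (hG : G.Connected) (B : SpanningTree G)
    (v u : V) {T : Ω → SpanningTree G} (hT : Measurable T)
    (hunif : ∀ t, P.real {x | T x = t} = 1 / (Nat.card (SpanningTree G) : ℝ)) :
    ∫ x, sampleValue B v (T x) u ∂P = lapPinv G u u := by
  rw [integral_comp_tree hT hunif fun t => sampleValue B v t u, sum_sampleValue hG,
    mul_div_cancel_left₀ _ (card_spanningTree_ne_zero B)]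

end Expectation

/-! ### Concentration and the error guarantee -/

/-- Two-sided Hoeffding inequality for the sum of independent variables with common mean `m` and
values in `[-b, b]`. -/
theorem measureReal_abs_sum_sub_ge_le {Ω : Type*} [MeasurableSpace Ω] {P : Measure Ω}
    [IsProbabilityMeasure P] {k : ℕ} {X : Fin k → Ω → ℝ} (hm : ∀ i, Measurable (X i))
    (hindep : iIndepFun X P) {b m t : ℝ} (hb : ∀ i x, |X i x| ≤ b)
    (hX : ∀ i, ∫ x, X i x ∂P = m) (ht : 0 ≤ t) :
    P.real {x | t ≤ |∑ i, (X i x - m)|} ≤ 2 * Real.exp (-t ^ 2 / (2 * (k * b ^ 2))) := by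
  have hi : ∀ i, Integrable (X i) P := fun i =>
    Integrable.of_bound (hm i).aestronglyMeasurable b (.of_forall fun x => hb i x)
  have hsub : ∀ i, HasSubgaussianMGF (fun x => X i x - m) (‖b‖₊ ^ 2) P := fun i => by
    have h := hasSubgaussianMGF_of_mem_Icc_of_integral_eq_zero (μ := P)
      (X := fun x => X i x - m) (a := -b - m) (b := b - m)
      ((hm i).sub_const m).aemeasurable
      (.of_forall fun x => by
        have := abs_le.1 (hb i x)
        constructor <;> linarith)
      (by rw [integral_sub (hi i) (integrable_const m), hX]; simp)
    -- Hoeffding's lemma takes the square of half the interval length 2b as variance proxy.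
    have hc : ‖b - m - (-b - m)‖₊ / 2 = ‖b‖₊ := by
      rw [show b - m - (-b - m) = 2 * b by ring, nnnorm_mul]
      simp
    rwa [hc] at h
  have hind : iIndepFun (fun i x => X i x - m) P :=
    hindep.comp (fun _ y => y - m) fun _ => measurable_id.sub_const m
  have hind' : iIndepFun (fun i x => -(X i x - m)) P :=
    hindep.comp (fun _ y => -(y - m)) fun _ => (measurable_id.sub_const m).neg
  have h1 := HasSubgaussianMGF.measure_sum_ge_le_of_iIndepFun (s := Finset.univ) hind
    (fun i _ => hsub i) ht
  have h2 := HasSubgaussianMGF.measure_sum_ge_le_of_iIndepFun (s := Finset.univ) hind'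
    (fun i _ => (hsub i).neg) ht
  have hsum : ((∑ _i : Fin k, ‖b‖₊ ^ 2 : NNReal) : ℝ) = k * b ^ 2 := by simp
  rw [hsum] at h1 h2
  refine (measureReal_mono (s₂ := {x | t ≤ ∑ i, (X i x - m)} ∪ {x | t ≤ ∑ i, -(X i x - m)})
    fun x hx => ?_).trans ((measureReal_union_le _ _).trans (by linarith))
  simp only [Finset.sum_neg_distrib, Set.mem_union, Set.mem_ofPred_eq] at hx ⊢
  exact le_abs.1 hx

/-- For deviation ωε of the sum and range 4d the exponent is -ωε²/(32d²), with 32 = 2 · 4²; the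
hypothesis puts it below -log(2n/pf). -/
theorem two_mul_exp_le_div {n d ω ε pf : ℝ} (hn : 0 < n) (hd : 0 < d) (hω : 0 < ω) (hε : 0 < ε)
    (hpf : 0 < pf) (h : 32 * d ^ 2 * Real.log (2 * n / pf) / ε ^ 2 ≤ ω) :
    2 * Real.exp (-(ω * ε) ^ 2 / (2 * (ω * (4 * d) ^ 2))) ≤ pf / n := by
  have h1 : -(ω * ε) ^ 2 / (2 * (ω * (4 * d) ^ 2)) ≤ Real.log (pf / (2 * n)) := by
    rw [← inv_div (2 * n), Real.log_inv]
    rw [div_le_iff₀ (by positivity)] at h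
    rw [div_le_iff₀ (by positivity)]
    linarith [mul_le_mul_of_nonneg_left h hω.le]
  calc _ ≤ 2 * Real.exp (Real.log (pf / (2 * n))) := by gcongr
    _ = pf / n := by
      rw [Real.exp_log (by positivity)]
      field_simp

/-- The entry is a mean of sample values. For diameter 0 this makes the target vanish. -/
theorem abs_lapPinv_diag_le [Fintype V] [DecidableEq V] [DecidableRel G.Adj] (hG : G.Connected)
    {v : V} {B : SpanningTree G} (hB : B.IsBFS v) (u : V) :
    |lapPinv G u u| ≤ 4 * (G.diam : ℝ) := by
  have hτ := card_spanningTree_ne_zero B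
  have hτ' : (0 : ℝ) < Fintype.card (SpanningTree G) := by positivity
  refine le_of_mul_le_mul_left ?_ hτ'
  rw [← abs_of_pos hτ', ← abs_mul, ← sum_sampleValue hG B v u, abs_of_pos hτ']
  calc _ ≤ ∑ T : SpanningTree G, |sampleValue B v T u| := Finset.abs_sum_le_sum_abs ..
    _ ≤ ∑ _T : SpanningTree G, 4 * (G.diam : ℝ) :=
      Finset.sum_le_sum fun T _ => abs_sampleValue_le hG hB T u
    _ = _ := by simp

theorem one_sub_le_measureReal_estimate [Fintype V] [DecidableEq V] [DecidableRel G.Adj]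
    (hG : G.Connected) {v : V} {B : SpanningTree G} (hB : B.IsBFS v)
    {Ω : Type*} [MeasurableSpace Ω] {P : Measure Ω} [IsProbabilityMeasure P]
    {ω : ℕ} {T : Fin ω → Ω → SpanningTree G} (hmeas : ∀ i, Measurable (T i))
    (hindep : iIndepFun T P)
    (hunif : ∀ i t, P.real {x | T i x = t} = 1 / (Nat.card (SpanningTree G) : ℝ))
    {ε pf : ℝ} (hε : 0 < ε) (hpf : 0 < pf)
    (h : 32 * (G.diam : ℝ) ^ 2 * Real.log (2 * (Fintype.card V : ℝ) / pf) / ε ^ 2 ≤ (ω : ℝ)) :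
    1 - pf ≤ P.real {x | ∀ u, |estimate B v (fun i => T i x) u - lapPinv G u u| ≤ ε} := by
  have : Nonempty V := ⟨v⟩
  have hn : (1 : ℝ) ≤ Fintype.card V := by exact_mod_cast Fintype.card_pos
  have hest : ∀ x u, estimate B v (fun i => T i x) u = (∑ i, sampleValue B v (T i x) u) / ω :=
    fun x u => estimate_eq ..
  -- At diameter 0 the Hoeffding exponent would divide by zero, but samples and target are all 0.
  rcases Nat.eq_zero_or_pos G.diam with hd | hd
  · have hall : {x | ∀ u, |estimate B v (fun i => T i x) u - lapPinv G u u| ≤ ε} = Set.univ := by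
      refine Set.eq_univ_of_forall fun x u => ?_
      have h1 : lapPinv G u u = 0 := by simpa [hd] using abs_lapPinv_diag_le hG hB u
      have h2 : ∀ t, sampleValue B v t u = 0 := fun t => by
        simpa [hd] using abs_sampleValue_le hG hB t u
      simp [hest, h1, h2, hε.le]
    rw [hall]
    simpa using hpf.le
  have hd' : (0 : ℝ) < G.diam := by exact_mod_cast hd
  -- With no samples the hypothesis forces pf ≥ 2n, so 1 - pf is negative.
  rcases Nat.eq_zero_or_pos ω with rfl | hω
  · have hlog : Real.log (2 * (Fintype.card V : ℝ) / pf) ≤ 0 := by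
      by_contra! hlog
      have : (0 : ℝ) < 32 * (G.diam : ℝ) ^ 2 * Real.log (2 * (Fintype.card V : ℝ) / pf) / ε ^ 2 := by
        positivity
      simp only [Nat.cast_zero] at h
      linarith
    have h1 : 2 * (Fintype.card V : ℝ) / pf ≤ 1 := by
      by_contra! h1
      linarith [Real.log_pos h1]
    rw [div_le_one hpf] at h1
    linarith [measureReal_nonneg (μ := P)
      (s := {x | ∀ u, |estimate B v (fun i => T i x) u - lapPinv G u u| ≤ ε})]
  have hω' : (0 : ℝ) < ω := by exact_mod_cast hω
  have hsv : ∀ u, Measurable fun t => sampleValue B v t u := fun u => measurable_from_top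
  have htail : ∀ u, P.real {x | ε < |estimate B v (fun i => T i x) u - lapPinv G u u|} ≤
      pf / Fintype.card V := fun u => by
    refine le_trans (measureReal_mono fun x hx => ?_)
      ((measureReal_abs_sum_sub_ge_le (P := P) (X := fun i x => sampleValue B v (T i x) u)
        (m := lapPinv G u u) (t := ω * ε) (fun i => (hsv u).comp (hmeas i))
        (hindep.comp (fun _ t => sampleValue B v t u) fun _ => hsv u)
        (fun i x => abs_sampleValue_le hG hB (T i x) u)
        (fun i => integral_sampleValue hG B v u (hmeas i) (hunif i)) (by positivity)).trans
        (two_mul_exp_le_div (by positivity) hd' hω' hε hpf h))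
    simp only [Set.mem_ofPred_eq, hest] at hx ⊢
    have hsum : ∑ i, (sampleValue B v (T i x) u - lapPinv G u u) =
        ω * ((∑ i, sampleValue B v (T i x) u) / ω - lapPinv G u u) := by
      rw [Finset.sum_sub_distrib]
      simp only [Finset.sum_const, Finset.card_univ, Fintype.card_fin, nsmul_eq_mul]
      field_simp
    rw [hsum, abs_mul, abs_of_pos hω']
    gcongr
  -- Bounding the measure of this cover by subadditivity requires no measurability of the events.
  have hcover : Set.univ ⊆ {x | ∀ u, |estimate B v (fun i => T i x) u - lapPinv G u u| ≤ ε} ∪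
      ⋃ u, {x | ε < |estimate B v (fun i => T i x) u - lapPinv G u u|} := fun x _ => by
    by_cases hx : ∀ u, |estimate B v (fun i => T i x) u - lapPinv G u u| ≤ ε
    · exact .inl hx
    · push Not at hx
      exact .inr (Set.mem_iUnion.2 hx)
  have hle := (measureReal_mono (μ := P) hcover).trans (measureReal_union_le _ _)
  have hU := measureReal_iUnion_fintype_le (μ := P)
    fun u => {x | ε < |estimate B v (fun i => T i x) u - lapPinv G u u|}
  have hsum : ∑ u, P.real {x | ε < |estimate B v (fun i => T i x) u - lapPinv G u u|} ≤ pf := by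
    calc _ ≤ ∑ _u : V, pf / (Fintype.card V : ℝ) := Finset.sum_le_sum fun u _ => htail u
      _ = pf := by
        simp only [Finset.sum_const, Finset.card_univ, nsmul_eq_mul]
        field_simp
  rw [probReal_univ] at hle
  linarith

end

end SpanTreeECC

theorem mainTheorem6 {V : Type*} [Fintype V] [DecidableEq V]
    (G : SimpleGraph V) [DecidableRel G.Adj] (hG : G.Connected)
    -- the landmark node and a BFS tree rooted at it
    (v : V) (B : SpanTreeECC.SpanningTree G) (hB : B.IsBFS v)
    -- `ω` independent uniformly random spanning trees
    {Ω : Type*} [MeasurableSpace Ω] (P : MeasureTheory.Measure Ω)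
    [MeasureTheory.IsProbabilityMeasure P]
    (ω : ℕ) (T : Fin ω → Ω → SpanTreeECC.SpanningTree G)
    (hmeas : ∀ i, Measurable (T i))
    (hindep : ProbabilityTheory.iIndepFun T P)
    (hunif : ∀ i t, P.real {x | T i x = t} = 1 / (Nat.card (SpanTreeECC.SpanningTree G) : ℝ)) :
    -- the per-sample values are bounded by `4 Δ_G`
    (∀ t u, |SpanTreeECC.sampleValue B v t u| ≤ 4 * (G.diam : ℝ)) ∧
    -- the estimator is unbiased
    (0 < ω → ∀ u,
      MeasureTheory.Integrable (fun x => SpanTreeECC.estimate B v (fun i => T i x) u) P ∧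
      ∫ x, SpanTreeECC.estimate B v (fun i => T i x) u ∂P = SpanTreeECC.lapPinv G u u) ∧
    -- the error guarantee
    (∀ ε pf : ℝ, 0 < ε → 0 < pf →
      32 * (G.diam : ℝ) ^ 2 * Real.log (2 * (Fintype.card V : ℝ) / pf) / ε ^ 2 ≤ (ω : ℝ) →
      1 - pf ≤ P.real {x | ∀ u,
        |SpanTreeECC.estimate B v (fun i => T i x) u - SpanTreeECC.lapPinv G u u| ≤ ε}) := by
  refine ⟨fun t u => SpanTreeECC.abs_sampleValue_le hG hB t u, fun hω u => ?_,
    fun ε pf hε hpf h =>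
      SpanTreeECC.one_sub_le_measureReal_estimate hG hB hmeas hindep hunif hε hpf h⟩
  have hint : ∀ i, MeasureTheory.Integrable (fun x => SpanTreeECC.sampleValue B v (T i x) u) P :=
    fun i => SpanTreeECC.integrable_comp_tree (hmeas i) fun t => SpanTreeECC.sampleValue B v t u
  simp only [SpanTreeECC.estimate_eq]
  refine ⟨(MeasureTheory.integrable_finsetSum _ fun i _ => hint i).div_const _, ?_⟩
  rw [MeasureTheory.integral_div, MeasureTheory.integral_finsetSum _ fun i _ => hint i]
  simp only [SpanTreeECC.integral_sampleValue hG B v u (hmeas _) (hunif _)]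
  have : (ω : ℝ) ≠ 0 := by exact_mod_cast hω.ne'
  simp only [Finset.sum_const, Finset.card_univ, Fintype.card_fin, nsmul_eq_mul]
  field_simp
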